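/- Let $\mathcal K$ be an accessible category with (small) directed colimits, and let $U:\mathcal K\to\mathbf{Set}$ be a faithful functor preserving directed colimits, such that every morphism of $\mathcal K$ is a monomorphism and is sent by $U$ to an injective map. For $n\in\mathbb N$ let $U^n:\mathcal K\to\mathbf{Set}$ be the functor $A\mapsto\mathbf{Set}(n,UA)$. The canonical signature $\Sigma_{\mathcal K}$ has as $n$-ary relation symbols the subfunctors of $U^n$ that preserve directed colimits, and as $n$-ary function symbols the natural transformations $U^n\to U$. Each $UA$ is a $\Sigma_{\mathcal K}$-structure in the evident way: a symbol $R\subseteq U^n$ is interpreted by $R(A)\subseteq (UA)^n$ and a symbol $h:U^n\to U$ by $h_A$. This gives a functor $G:\mathcal K\to\mathrm{Str}(\Sigma_{\mathcal K})$ to structures and homomorphisms and, for every subsignature $\Sigma\subseteq\Sigma_{\mathcal K}$, an induced functor $G_\Sigma:\mathcal K\to\mathrm{Str}(\Sigma)$. Then: 1. For every $n$ there is only a set (not a proper class) of $n$-ary symbols in $\Sigma_{\mathcal K}$. 2. Among the subsignatures $\Sigma$ of $\Sigma_{\mathcal K}$ such that $G_\Sigma$ sends every morphism to an embedding of structures (an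 injective map that preserves and reflects all relations of $\Sigma$) there is a largest one, $\Sigma_0$. Write $G_0=G_{\Sigma_0}$. 3. $(\mathcal K,U)$ is an abstract elementary class if and only if both of the following hold: (a) $(\mathcal K,U)$ is coherent: whenever $h:A\to C$ and $g:B\to C$ are morphisms of $\mathcal K$ and $f:UA\to UB$ is a map with $U(g)\circ f=U(h)$, there is $\bar f:A\to B$ in $\mathcal K$ with $U(\bar f)=f$; (b) $G_0$ is iso-full: for all objects $A,B$, every bijection $f:UA\to UB$ that is an isomorphism of $\Sigma_0$-structures $G_0A\cong G_0B$ is of the form $f=U(\bar f)$ for some $\bar f:A\to B$ in $\mathcal K$. Here "$(\mathcal K,U)$ is an abstract elementary class" means that there are a (small) finitary signature $L$ and an abstract elementary class of (possibly empty) $L$-structures such that $\mathcal K$ is equivalent to the category of its members and strong embeddings, by an equivalence commuting up to natural isomorphism with the functors to $\mathbf{Set}$. An abstract elementary class consists of a class of $L$-structures and a relation $M\prec N$ between members of it that refines the substructure relation, both closed under isomorphism, such that $\prec$ is reflexive and transitive; $M_0\prec N$, $M_1\prec N$ and $M_0\subseteq M_1$ imply $M_0\prec M_1$; the union of a continuous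 $\prec$-increasing (nonempty, well-ordered) chain belongs to the class, each member of the chain is $\prec$ the union, and the union is $\prec N$ whenever all members of the chain are $\prec N$; and there is an infinite cardinal $\kappa\ge|L|$ such that for each member $N$ and each subset $X\subseteq N$ there is $M\prec N$ with $X\subseteq M$ and $|M|\le\max(|X|,\kappa)$. A strong embedding is an embedding whose image is $\prec$ its codomain. -/

import Mathlib

open CategoryTheory

universe u v a b c d

namespace LanguageFreeAEC

open CategoryTheory.Limits FirstOrder FirstOrder.Language

/-! ### Directed colimits, coherence -/

/-- `K` has colimits of all (`u`-small, nonempty) directed posets. -/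
def HasDirectedColimits (K : Type v) [Category.{u} K] : Prop :=
  ∀ (I : Type u) [PartialOrder I] [IsDirectedOrder I] [Nonempty I], HasColimitsOfShape I K

/-- `F` preserves colimits of all (`u`-small, nonempty) directed posets. -/
def PreservesDirectedColimits {K : Type v} [Category.{u} K] (F : K ⥤ Type u) : Prop :=
  ∀ (I : Type u) [PartialOrder I] [IsDirectedOrder I] [Nonempty I], PreservesColimitsOfShape I F

/-- `(K, U)` is coherent: a map `f : UA → UB` whose composite with some `U(g)`, `g : B ⟶ C`, is
of the form `U(h)`, `h : A ⟶ C`, is itself of the form `U(f')`, `f' : A ⟶ B`. -/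
def IsCoherent {K : Type v} [Category.{u} K] (U : K ⥤ Type u) : Prop :=
  ∀ ⦃A B C : K⦄ (h : A ⟶ C) (g : B ⟶ C) (f : U.obj A ⟶ U.obj B),
    f ≫ U.map g = U.map h → ∃ f' : A ⟶ B, U.map f' = f

/-! ### Structures, homomorphisms, embeddings -/

/-- The objects of `Str(L)`: structures of the finitary signature `L`. -/
structure Str (L : FirstOrder.Language.{a, b}) where
  /-- the underlying set -/
  carrier : Type u
  /-- the interpretation of the symbols -/
  [str : L.Structure carrier]

attribute [instance] Str.str

/-- `Str(L)`, the category of `L`-structures and homomorphisms. -/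
instance (L : FirstOrder.Language.{a, b}) : Category.{u} (Str.{u} L) where
  Hom M N := M.carrier →[L] N.carrier
  id M := Hom.id L M.carrier
  comp f g := Hom.comp g f

/-- The reduct functor `Str(L) ⥤ Str(L')` along a map of signatures `L' → L`. -/
def Str.reduct {L' : FirstOrder.Language.{a, b}} {L : FirstOrder.Language.{c, d}} (φ : L' →ᴸ L) :
    Str.{u} L ⥤ Str.{u} L' where
  obj M := @Str.mk L' M.carrier (φ.reduct M.carrier)
  map {M N} f :=
    @Hom.mk L' M.carrier N.carrier (φ.reduct M.carrier) (φ.reduct N.carrier) f.toFun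
      (fun g x => f.map_fun' (φ.onFunction g) x)
      (fun r x => f.map_rel' (φ.onRelation r) x)

/-- A homomorphism is a morphism of `Emb(L)` if it is an embedding of structures: injective and
both preserving and reflecting the relations. -/
def IsEmb {L : FirstOrder.Language.{a, b}} {M N : Str.{u} L} (f : M ⟶ N) : Prop :=
  ∃ e : M.carrier ↪[L] N.carrier, e.toHom = f

/-- A functor to structures is iso-full if each isomorphism of structures between values of the
functor is the image of a morphism. -/
def IsIsoFull {L : FirstOrder.Language.{a, b}} {K : Type v} [Category.{u} K] (G : K ⥤ Str.{u} L) : Prop :=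
  ∀ ⦃A B : K⦄ (e : (G.obj A).carrier ≃[L] (G.obj B).carrier), ∃ f : A ⟶ B, G.map f = e.toHom

/-- A subsignature of `L`: a choice of some of the function and relation symbols. -/
@[ext]
structure Subsignature (L : FirstOrder.Language.{a, b}) where
  /-- the chosen function symbols -/
  funs : ∀ n, Set (L.Functions n)
  /-- the chosen relation symbols -/
  rels : ∀ n, Set (L.Relations n)

namespace Subsignature

variable {L : FirstOrder.Language.{a, b}}

/-- Subsignatures are ordered by inclusion. -/
instance : PartialOrder (Subsignature L) :=
  PartialOrder.lift (fun S => (S.funs, S.rels)) (fun S T h => by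
    cases S; cases T; simpa using h)

/-- The union of a family of subsignatures. -/
def union (F : Set (Subsignature L)) : Subsignature L where
  funs n := {g | ∃ S ∈ F, g ∈ S.funs n}
  rels n := {r | ∃ S ∈ F, r ∈ S.rels n}

/-- A subsignature, as a signature. -/
def toLanguage (S : Subsignature L) : FirstOrder.Language.{a, b} where
  Functions n := S.funs n
  Relations n := S.rels n

/-- The inclusion of a subsignature. -/
def incl (S : Subsignature L) : S.toLanguage →ᴸ L where
  onFunction _ g := g.1
  onRelation _ r := r.1

end Subsignature

/-! ### The canonical signature -/

section Canonical

variable {K : Type v} [Category.{u} K] (U : K ⥤ Type u)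

/-- The functor `Uⁿ`, that is `A ↦ Set(n, UA)`. -/
def power (n : ℕ) : K ⥤ Type u where
  obj A := Fin n → U.obj A
  map f := ↾fun x i => U.map f (x i)

/-- The canonical signature of `(K, U)`. The `n`-ary function symbols are the natural
transformations `Uⁿ ⟶ U`, the `n`-ary relation symbols are the subfunctors of `Uⁿ` that preserve
directed colimits. -/
def canonicalSignature : FirstOrder.Language.{max u v, max u v} where
  Functions n := power U n ⟶ U
  Relations n := {R : Subfunctor (power U n) // PreservesDirectedColimits R.toFunctor}

/-- The structure of the canonical signature carried by the set `UA`. -/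
def canonicalStr (A : K) : Str.{u} (canonicalSignature U) where
  carrier := U.obj A
  str :=
    { funMap := fun {n} (h : power U n ⟶ U) x => h.app A x
      RelMap := fun {n} (R : {R : Subfunctor (power U n) //
        PreservesDirectedColimits R.toFunctor}) x => x ∈ R.1.obj A }

/-- The canonical functor `G : K ⥤ Str(Σ)` to structures of the canonical signature. -/
def canonicalFunctor : K ⥤ Str.{u} (canonicalSignature U) where
  obj A := canonicalStr U A
  map {A B} f :=
    { toFun := fun x : U.obj A => (U.map f x : U.obj B)
      map_fun' := fun {n} (h : power U n ⟶ U) x =>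
        (ConcreteCategory.congr_hom (h.naturality f) x).symm
      map_rel' := fun {n} (R : {R : Subfunctor (power U n) //
        PreservesDirectedColimits R.toFunctor}) _ hx => R.1.map f hx }
  map_id A := FirstOrder.Language.Hom.ext fun x =>
    ConcreteCategory.congr_hom (U.map_id A) x
  map_comp f g := FirstOrder.Language.Hom.ext fun x =>
    ConcreteCategory.congr_hom (U.map_comp f g) x

/-- The functor `K ⥤ Str(S)` induced by the canonical functor, for a subsignature `S` of the
canonical signature. -/
def inducedFunctor (S : Subsignature (canonicalSignature U)) : K ⥤ Str.{u} S.toLanguage :=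
  canonicalFunctor U ⋙ Str.reduct S.incl

/-- The functor induced by the subsignature `S` has its image in `Emb(S)`. -/
def LandsInEmb (S : Subsignature (canonicalSignature U)) : Prop :=
  ∀ ⦃A B : K⦄ (f : A ⟶ B), IsEmb ((inducedFunctor U S).map f)

/-- `Σ₀`: the union of the subsignatures of the canonical signature for which the induced functor
has its image in embeddings. (That it is the largest one is part of the theorem.) -/
def embeddingSignature : Subsignature (canonicalSignature U) :=
  Subsignature.union {S | LandsInEmb U S}

end Canonical

/-! ### Abstract elementary classes -/

/-- An abstract elementary class in the (small, finitary) signature `L`: a class of `L`-structures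
together with a relation `S ≺ N` between structures `N` and their substructures `S`. For
`S ≤ T ≤ N` the substructure `S` of `T` is `S.comap T.subtype.toHom`. Structures may be empty. -/
structure AEC (L : FirstOrder.Language.{u, u}) where
  /-- `M` belongs to the class -/
  Mem : ∀ (M : Type u) [L.Structure M], Prop
  /-- `S ≺ N` -/
  Strong : ∀ {N : Type u} [L.Structure N], L.Substructure N → Prop
  /-- the relation `≺` is between members of the class -/
  mem_of_strong : ∀ {N : Type u} [L.Structure N] (S : L.Substructure N),
    Strong S → Mem S ∧ Mem N
  /-- the class is closed under isomorphism -/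
  mem_of_equiv : ∀ {M N : Type u} [L.Structure M] [L.Structure N] (_ : M ≃[L] N), Mem M → Mem N
  /-- the relation `≺` is closed under isomorphism -/
  strong_of_equiv : ∀ {M N : Type u} [L.Structure M] [L.Structure N] (e : M ≃[L] N)
    (S : L.Substructure M), Strong S → Strong (S.map e.toHom)
  /-- `M ≺ M` -/
  strong_top : ∀ (M : Type u) [L.Structure M], Mem M → Strong (⊤ : L.Substructure M)
  /-- `T ≺ S ≺ N` implies `T ≺ N` -/
  strong_trans : ∀ {N : Type u} [L.Structure N] (S : L.Substructure N) (T : L.Substructure S),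
    Strong T → Strong S → Strong (T.map S.subtype.toHom)
  /-- coherence: if `S ≺ N`, `T ≺ N` and `S ≤ T` then `S ≺ T` -/
  coherence : ∀ {N : Type u} [L.Structure N] (S T : L.Substructure N),
    S ≤ T → Strong S → Strong T → Strong (S.comap T.subtype.toHom)
  /-- the union `N` of a continuous `≺`-increasing chain belongs to the class and each member of
  the chain is `≺ N` -/
  chain_union : ∀ {N : Type u} [L.Structure N] {I : Type u} [LinearOrder I] [WellFoundedLT I]
    [Nonempty I] (C : I → L.Substructure N), Monotone C →
    (∀ i, Order.IsSuccLimit i → C i = ⨆ j : Set.Iio i, C j) →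
    (∀ i j, i ≤ j → Strong ((C i).comap (C j).subtype.toHom)) →
    (⨆ i, C i) = ⊤ → Mem N ∧ ∀ i, Strong (C i)
  /-- if moreover all members of the chain are `≺ N`, where `N` need not be the union, then the
  union is `≺ N` -/
  chain_smooth : ∀ {N : Type u} [L.Structure N] {I : Type u} [LinearOrder I] [WellFoundedLT I]
    [Nonempty I] (C : I → L.Substructure N), Monotone C →
    (∀ i, Order.IsSuccLimit i → C i = ⨆ j : Set.Iio i, C j) →
    (∀ i, Strong (C i)) → Strong (⨆ i, C i)
  /-- there is a Löwenheim–Skolem number -/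
  lowenheim_skolem : ∃ κ : Cardinal.{u}, Cardinal.aleph0 ≤ κ ∧ L.card ≤ κ ∧
    ∀ (N : Type u) [L.Structure N], Mem N → ∀ X : Set N, ∃ S : L.Substructure N,
      X ⊆ (S : Set N) ∧ Strong S ∧ Cardinal.mk S ≤ max (Cardinal.mk X) κ

namespace AEC

variable {L : FirstOrder.Language.{u, u}} (𝔸 : AEC L)

/-- The members of an abstract elementary class. -/
structure Model where
  /-- the underlying set -/
  carrier : Type u
  /-- the structure -/
  [str : L.Structure carrier]
  /-- it belongs to the class -/
  mem : 𝔸.Mem carrier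

attribute [instance] Model.str

/-- A strong embedding: an embedding of structures whose image is `≺` the codomain. -/
def IsStrongEmbedding {M N : Type u} [L.Structure M] [L.Structure N] (f : M ↪[L] N) : Prop :=
  𝔸.Strong f.toHom.range

theorem isStrongEmbedding_refl (M : Type u) [L.Structure M] (h : 𝔸.Mem M) :
    𝔸.IsStrongEmbedding (Embedding.refl L M) := by
  have : (Embedding.refl L M).toHom.range = ⊤ := by
    ext x
    simp
  unfold IsStrongEmbedding
  rw [this]
  exact 𝔸.strong_top M h

theorem isStrongEmbedding_comp {M N P : Type u} [L.Structure M] [L.Structure N] [L.Structure P]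
    (g : N ↪[L] P) (f : M ↪[L] N) (hg : 𝔸.IsStrongEmbedding g) (hf : 𝔸.IsStrongEmbedding f) :
    𝔸.IsStrongEmbedding (g.comp f) := by
  have h := 𝔸.strong_trans _ _ (𝔸.strong_of_equiv g.equivRange _ hf) hg
  have e : (Substructure.map g.toHom.range.subtype.toHom
      (Substructure.map g.equivRange.toHom f.toHom.range)) = (g.comp f).toHom.range := by
    ext x
    simp [Hom.mem_range, Substructure.mem_map]
  rw [e] at h
  exact h

/-- An abstract elementary class as a category: the morphisms are the strong embeddings. -/
instance : Category.{u} 𝔸.Model where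
  Hom M N := {f : M.carrier ↪[L] N.carrier // 𝔸.IsStrongEmbedding f}
  id M := ⟨Embedding.refl L M.carrier, 𝔸.isStrongEmbedding_refl _ M.mem⟩
  comp f g := ⟨g.1.comp f.1, 𝔸.isStrongEmbedding_comp _ _ g.2 f.2⟩

/-- The underlying set functor of an abstract elementary class. -/
def forget : 𝔸.Model ⥤ Type u where
  obj M := M.carrier
  map f := ↾fun x => f.1 x

end AEC

/-- `(K, U)` is an abstract elementary class: for some signature `L` and some abstract elementary
class of `L`-structures, `K` is equivalent to the category of members of the class and strong
embeddings, through an equivalence that commutes, up to natural isomorphism, with the functors to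
sets. -/
def IsAEC {K : Type v} [Category.{u} K] (U : K ⥤ Type u) : Prop :=
  ∃ (L : FirstOrder.Language.{u, u}) (𝔸 : AEC L) (F : K ⥤ 𝔸.Model),
    F.IsEquivalence ∧ Nonempty (F ⋙ 𝔸.forget ≅ U)

end LanguageFreeAEC

open LanguageFreeAEC

namespace LanguageFreeAEC

open CategoryTheory.Limits FirstOrder FirstOrder.Language

/-! ### Accessible categories and directed colimits -/

section Presentation

variable {K : Type v} [Category.{u} K]

/-! Every object is a directed colimit of objects from a small collection. Since symbols are
finitary, naturality (for functions) and preservation of directed colimits (for relations) determine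
a symbol by its values on that collection (`small_functions`, `small_relations`). Having embeddings
as values is a condition on each relation symbol separately (`landsInEmb_iff`), so the union of all
good subsignatures is good.

If `(K, U)` is an AEC of `L`-structures, every symbol of `L` becomes a canonical symbol. Strong
embeddings reflect relations, so these symbols lie in `Σ₀`; an isomorphism of `Σ₀`-structures is
then one of `L`-structures, hence strong, hence a morphism. Coherence is that of the AEC.

Conversely, take a small copy of `Σ₀` as signature, the structures isomorphic to some `UA` as
members, and the inclusions isomorphic to morphisms (`IsMor`) as `≺`. Iso-fullness makes `IsMor`
independent of the chosen isomorphisms (`exists_hom`), coherence of `U` gives the coherence axiom,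
directed colimits give unions of chains (`exists_directed_union`), and accessibility gives a
Löwenheim–Skolem number (`exists_lowenheimSkolem_cardinal`). -/

/-- In an accessible category, each object is the colimit of a directed diagram of objects from
some small collection. -/
theorem exists_small_directed_generator (K : Type v) [Category.{u} K]
    [IsAccessibleCategory.{u} K] :
    ∃ (P : ObjectProperty K) (_ : ObjectProperty.Small.{u} P), ∀ B : K,
      ∃ (I : Type u) (_ : PartialOrder I) (_ : IsDirectedOrder I) (_ : Nonempty I),
        Nonempty (P.ColimitOfShape I B) := by
  obtain ⟨κ, _, _⟩ := IsAccessibleCategory.exists_cardinal.{u} K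
  obtain ⟨P, _, hP⟩ := HasCardinalFilteredGenerator.exists_small_generator K κ
  refine ⟨P, inferInstance, fun B => ?_⟩
  obtain ⟨J, _, _, ⟨p⟩⟩ := hP.exists_colimitsOfShape B
  have := isFiltered_of_isCardinalFiltered J κ
  obtain ⟨I, _, _, _, F, _⟩ := IsFiltered.exists_directed J
  exact ⟨I, inferInstance, inferInstance, inferInstance, ⟨p.reindex F⟩⟩

variable {F : K ⥤ Type u} {I : Type u} [PartialOrder I] {D : I ⥤ K} {s : Cocone D}

theorem map_ι_map (F : K ⥤ Type u) (s : Cocone D) {i j : I} (h : i ≤ j) (y : F.obj (D.obj i)) :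
    F.map (s.ι.app j) (F.map (D.map (homOfLE h)) y) = F.map (s.ι.app i) y := by
  rw [← s.w (homOfLE h), F.map_comp]
  rfl

theorem map_desc_map_ι (F : K ⥤ Type u) (hs : IsColimit s) (t : Cocone D) (i : I)
    (y : F.obj (D.obj i)) : F.map (hs.desc t) (F.map (s.ι.app i) y) = F.map (t.ι.app i) y := by
  rw [← hs.fac t i, F.map_comp]
  rfl

variable [IsDirectedOrder I] [Nonempty I]

theorem exists_eq_map_ι (hF : PreservesDirectedColimits F) (hs : IsColimit s) (x : F.obj s.pt) :
    ∃ (i : I) (y : F.obj (D.obj i)), F.map (s.ι.app i) y = x := by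
  have := hF I
  obtain ⟨i, y, hy⟩ := Types.jointly_surjective_of_isColimit (isColimitOfPreserves F hs) x
  exact ⟨i, y, hy⟩

theorem exists_eq_map_ι_tuple (hF : PreservesDirectedColimits F) (hs : IsColimit s) {n : ℕ}
    (x : Fin n → F.obj s.pt) :
    ∃ (i : I) (y : Fin n → F.obj (D.obj i)), (fun k => F.map (s.ι.app i) (y k)) = x := by
  choose i y hy using fun k => exists_eq_map_ι hF hs (x k)
  obtain ⟨j, hj⟩ := Finite.exists_le i
  exact ⟨j, fun k => F.map (D.map (homOfLE (hj k))) (y k), funext fun k => by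
    rw [map_ι_map, hy]⟩

/-- A subfunctor of `Uⁿ` that is reflected by all morphisms preserves directed colimits, if `U`
does and takes values in injective maps. -/
theorem preservesDirectedColimits_of_reflected {U : K ⥤ Type u} (hU : PreservesDirectedColimits U)
    (hinj : ∀ {A B : K} (f : A ⟶ B), Function.Injective (U.map f)) {n : ℕ}
    (R : Subfunctor (power U n))
    (hR : ∀ {A B : K} (f : A ⟶ B) (x : Fin n → U.obj A),
      (fun k => U.map f (x k)) ∈ R.obj B → x ∈ R.obj A) :
    PreservesDirectedColimits R.toFunctor := by
  intro I _ _ _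
  refine ⟨fun {D} => ⟨fun {s} hs => ⟨Types.FilteredColimit.isColimitOf' _ _ ?_ ?_⟩⟩⟩
  -- A tuple in the colimit lifts to one stage because `U` preserves the colimit; reflection puts
  -- the lift in `R`.
  · rintro ⟨x, hx⟩
    obtain ⟨i, y, rfl⟩ := exists_eq_map_ι_tuple hU hs x
    exact ⟨i, ⟨y, hR _ _ hx⟩, rfl⟩
  · rintro i ⟨x, hx⟩ ⟨y, hy⟩ h
    refine ⟨i, 𝟙 i, congrArg _ (Subtype.ext ?_)⟩
    have h' := congrArg Subtype.val h
    exact funext fun k => hinj _ (congrFun h' k)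

/-- A directed colimit of injective maps is injective. -/
theorem map_ι_injective_of_directed {X : Type*} (hF : PreservesDirectedColimits F)
    (hs : IsColimit s) (g : F.obj s.pt → X)
    (hg : ∀ i, Function.Injective fun y : F.obj (D.obj i) => g (F.map (s.ι.app i) y)) :
    Function.Injective g := by
  intro x x' h
  obtain ⟨i, y, rfl⟩ := exists_eq_map_ι hF hs x
  obtain ⟨j, z, rfl⟩ := exists_eq_map_ι hF hs x'
  obtain ⟨k, hik, hjk⟩ := exists_ge_ge i j
  rw [← map_ι_map F s hik, ← map_ι_map F s hjk] at h ⊢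
  rw [hg k h]

end Presentation

/-! ### There are only set-many symbols -/

section Small

variable {K : Type v} [Category.{u} K] [IsAccessibleCategory.{u} K] {U : K ⥤ Type u}

theorem small_functions (hU : PreservesDirectedColimits U) (n : ℕ) :
    Small.{u} ((canonicalSignature U).Functions n) := by
  obtain ⟨P, _, hP⟩ := exists_small_directed_generator.{u} K
  let r (h : power U n ⟶ U) (j : Subtype P) (x : Fin n → U.obj j.1) : U.obj j.1 := h.app j.1 x
  refine small_of_injective (β := ∀ j : Subtype P, (Fin n → U.obj j.1) → U.obj j.1) (f := r) ?_
  intro h h' e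
  refine NatTrans.ext (funext fun B => ConcreteCategory.hom_ext _ _ fun x => ?_)
  obtain ⟨I, _, _, _, ⟨p⟩⟩ := hP B
  obtain ⟨i, y, rfl⟩ := exists_eq_map_ι_tuple hU p.isColimit x
  have nat (g : power U n ⟶ U) : g.app B (fun k => U.map (p.ι.app i) (y k)) =
      U.map (p.ι.app i) (g.app _ y) := ConcreteCategory.congr_hom (g.naturality (p.ι.app i)) y
  have key : h.app _ y = h'.app _ y := congrFun (congrFun e ⟨_, p.prop_diag_obj i⟩) y
  exact (nat h).trans ((congrArg _ key).trans (nat h').symm)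

/-- An element of `R(B)` comes from an element of `R` at some stage of a diagram of generators,
because `R` itself preserves directed colimits. -/
theorem small_relations (n : ℕ) : Small.{u} ((canonicalSignature U).Relations n) := by
  obtain ⟨P, _, hP⟩ := exists_small_directed_generator.{u} K
  let r (R : {R : Subfunctor (power U n) // PreservesDirectedColimits R.toFunctor})
    (j : Subtype P) : Set (Fin n → U.obj j.1) := R.1.obj j.1
  refine small_of_injective (β := ∀ j : Subtype P, Set (Fin n → U.obj j.1)) (f := r) ?_
  have key (R S : {R : Subfunctor (power U n) // PreservesDirectedColimits R.toFunctor})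
      (e : r R = r S) : R.1 ≤ S.1 := by
    intro B x hx
    obtain ⟨I, _, _, _, ⟨p⟩⟩ := hP B
    obtain ⟨i, ⟨y, hy⟩, e'⟩ := exists_eq_map_ι R.2 p.isColimit ⟨x, hx⟩
    have hy' : y ∈ S.1.obj (p.diag.obj i) := by
      have h : R.1.obj (p.diag.obj i) = S.1.obj (p.diag.obj i) :=
        congrFun e ⟨_, p.prop_diag_obj i⟩
      exact h ▸ hy
    have hxy : (power U n).map (p.ι.app i) y = x := congrArg Subtype.val e'
    exact hxy ▸ S.1.map (p.ι.app i) hy'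
  exact fun R S e => Subtype.ext (le_antisymm (key R S e) (key S R e.symm))

end Small

/-! ### The largest subsignature for which morphisms are embeddings -/

section Embedding

variable {K : Type v} [Category.{u} K] {U : K ⥤ Type u}

/-- Naturality already makes every morphism respect function symbols, so only reflection of
relations is at stake, one symbol at a time. -/
theorem landsInEmb_iff (hinj : ∀ {A B : K} (f : A ⟶ B), Function.Injective (U.map f))
    (S : Subsignature (canonicalSignature U)) :
    LandsInEmb U S ↔ ∀ (n : ℕ), ∀ R ∈ S.rels n, ∀ ⦃A B : K⦄ (f : A ⟶ B) (x : Fin n → U.obj A),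
      (fun k => U.map f (x k)) ∈ R.1.obj B → x ∈ R.1.obj A := by
  constructor
  · intro h n R hR A B f x hx
    obtain ⟨e, he⟩ := h f
    have hx' : Structure.RelMap (L := S.toLanguage) (M := ((inducedFunctor U S).obj B).carrier)
        (⟨R, hR⟩ : S.toLanguage.Relations n) (e ∘ x) := by
      have : (e ∘ x) = fun k => U.map f (x k) :=
        funext fun k => DFunLike.congr_fun he (x k)
      rw [this]
      exact hx
    exact (e.map_rel _ _).1 hx'
  · intro h A B f
    exact ⟨⟨⟨U.map f, hinj f⟩, ((inducedFunctor U S).map f).map_fun',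
      fun R x => ⟨h _ R.1 R.2 f x, ((inducedFunctor U S).map f).map_rel' R x⟩⟩, rfl⟩

theorem isGreatest_embeddingSignature
    (hinj : ∀ {A B : K} (f : A ⟶ B), Function.Injective (U.map f)) :
    IsGreatest {S : Subsignature (canonicalSignature U) | LandsInEmb U S}
      (embeddingSignature U) := by
  constructor
  · refine (landsInEmb_iff hinj _).2 ?_
    rintro n R ⟨S, hS, hR⟩
    exact (landsInEmb_iff hinj S).1 hS n R hR
  · exact fun S hS => ⟨fun n g hg => ⟨S, hS, hg⟩, fun n R hR => ⟨S, hS, hR⟩⟩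

theorem mem_embeddingSignature_rels
    (hinj : ∀ {A B : K} (f : A ⟶ B), Function.Injective (U.map f)) {n : ℕ}
    (R : (canonicalSignature U).Relations n)
    (h : ∀ ⦃A B : K⦄ (f : A ⟶ B) (x : Fin n → U.obj A),
      (fun k => U.map f (x k)) ∈ R.1.obj B → x ∈ R.1.obj A) :
    R ∈ (embeddingSignature U).rels n := by
  -- The subsignature whose only symbol is `R`; the arity has to be transported along `m = n`.
  refine ⟨⟨fun _ => ∅, fun m => {S | ∃ e : m = n, e ▸ S = R}⟩, ?_, rfl, rfl⟩
  refine (landsInEmb_iff hinj _).2 ?_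
  rintro m S ⟨rfl, rfl⟩
  exact h

theorem mem_embeddingSignature_funs
    (hinj : ∀ {A B : K} (f : A ⟶ B), Function.Injective (U.map f)) {n : ℕ}
    (g : (canonicalSignature U).Functions n) : g ∈ (embeddingSignature U).funs n :=
  ⟨⟨fun _ => Set.univ, fun _ => ∅⟩,
    (landsInEmb_iff hinj _).2 fun _ _ hR => hR.elim, Set.mem_univ _⟩

end Embedding

/-! ### Downward Löwenheim–Skolem -/

/-- By recursion on `⊂`, `φ s` bounds the finitely many earlier values and the `i x` with `x ∈ s`.
This replaces an index poset of unknown size by `Finset X`. -/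
theorem exists_monotone_finset {X : Type*} {I : Type*} [PartialOrder I] [IsDirectedOrder I]
    [Nonempty I] (i : X → I) : ∃ φ : Finset X → I, Monotone φ ∧ ∀ x, i x ≤ φ {x} := by
  have bound (s : Finset X) (F : ∀ t, t ⊂ s → I) :
      ∃ b, (∀ t ht, F t ht ≤ b) ∧ ∀ x ∈ s, i x ≤ b := by
    have : Finite {t // t ⊂ s} :=
      (s.powerset.finite_toSet.subset fun t ht => Finset.mem_powerset.2 ht.1).to_subtype
    obtain ⟨b, hb⟩ := Finite.exists_le
      (Sum.elim (fun t : {t // t ⊂ s} => F t.1 t.2) fun x : s => i x)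
    exact ⟨b, fun t ht => hb (.inl ⟨t, ht⟩), fun x hx => hb (.inr ⟨x, hx⟩)⟩
  choose b hb hb' using bound
  let φ : Finset X → I := Finset.strongInduction b
  have hφ (s : Finset X) : φ s = b s fun t _ => φ t := Finset.strongInduction_eq b s
  refine ⟨φ, fun t s hts => ?_, fun x => ?_⟩
  · obtain rfl | hts := hts.eq_or_ssubset
    · exact le_rfl
    · rw [hφ s]
      exact hb s (fun t _ => φ t) t hts
  · rw [hφ]
    exact hb' _ _ x (Finset.mem_singleton_self x)

open Cardinal in
-- Write `B` as a directed colimit of generators and choose a stage for each element of `X`.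
-- Restricting the diagram along a monotone `Finset X → I` gives a colimit that maps to `B`, covers
-- `X`, and is a union of at most `max #X ℵ₀` images of sets of bounded size.
theorem exists_lowenheimSkolem_cardinal {K : Type v} [Category.{u} K]
    [IsAccessibleCategory.{u} K] (hK : HasDirectedColimits K) {U : K ⥤ Type u}
    (hU : PreservesDirectedColimits U) :
    ∃ κ : Cardinal.{u}, ℵ₀ ≤ κ ∧ ∀ (B : K) (X : Set (U.obj B)),
      ∃ (A : K) (f : A ⟶ B), X ⊆ Set.range (U.map f) ∧ #(U.obj A) ≤ max #X κ := by
  obtain ⟨P, _, hP⟩ := exists_small_directed_generator.{u} K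
  obtain ⟨κ, hκ⟩ : BddAbove (Set.range fun j : Subtype P => #(U.obj j.1)) := by
    exact Cardinal.bddAbove_of_small
  refine ⟨max κ ℵ₀, le_max_right _ _, fun B X => ?_⟩
  obtain ⟨I, _, _, _, ⟨p⟩⟩ := hP B
  choose i y hy using fun x : X => exists_eq_map_ι hU p.isColimit x.1
  obtain ⟨φ, hφ, hiφ⟩ := exists_monotone_finset i
  classical
  have := hK (Finset X)
  let D : Finset X ⥤ K := hφ.functor ⋙ p.diag
  let s : Cocone D := ⟨B, Functor.whiskerLeft hφ.functor p.ι⟩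
  refine ⟨colimit D, colimit.desc D s, fun x hx => ?_, ?_⟩
  · refine ⟨U.map (colimit.ι D {⟨x, hx⟩}) (U.map (p.diag.map (homOfLE (hiφ ⟨x, hx⟩))) (y ⟨x, hx⟩)),
      ?_⟩
    refine (map_desc_map_ι U (colimit.isColimit D) s {⟨x, hx⟩} _).trans ?_
    exact (map_ι_map U (Cocone.mk _ p.ι) (hiφ ⟨x, hx⟩) (y ⟨x, hx⟩)).trans (hy ⟨x, hx⟩)
  · have hsurj : Function.Surjective fun z : Σ t : Finset X, U.obj (D.obj t) =>
        U.map (colimit.ι D z.1) z.2 := fun z => by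
      obtain ⟨t, w, hw⟩ := exists_eq_map_ι hU (colimit.isColimit D) z
      exact ⟨⟨t, w⟩, hw⟩
    have hfin : #(Finset X) ≤ max #X ℵ₀ := by
      cases finite_or_infinite X
      · exact (Cardinal.mk_le_aleph0).trans (le_max_right _ _)
      · exact (Cardinal.mk_finset_of_infinite X).le.trans (le_max_left _ _)
    calc #(U.obj (colimit D)) ≤ #(Σ t : Finset X, U.obj (D.obj t)) := mk_le_of_surjective hsurj
      _ = Cardinal.sum fun t : Finset X => #(U.obj (D.obj t)) := mk_sigma _
      _ ≤ #(Finset X) * κ := by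
        refine (Cardinal.sum_le_sum _ (fun _ => κ) fun t =>
          hκ ⟨⟨_, p.prop_diag_obj _⟩, rfl⟩).trans ?_
        simp
      _ ≤ max #X (max κ ℵ₀) * max #X (max κ ℵ₀) := by
        refine mul_le_mul' (hfin.trans ?_) ?_
        · exact max_le_max le_rfl (le_max_right _ _)
        · exact (le_max_left _ _).trans (le_max_right _ _)
      _ = max #X (max κ ℵ₀) :=
        Cardinal.mul_eq_self ((le_max_right κ ℵ₀).trans (le_max_right _ _))

/-! ### Concrete categories of structures -/

section Presents

variable {K : Type v} [Category.{u} K] {U : K ⥤ Type u}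
  {L : FirstOrder.Language.{u, u}} [∀ A, L.Structure (U.obj A)]

variable (U L) in
/-- A choice of `L`-structures on the sets `UA` for which the morphisms are embeddings,
isomorphisms of structures are morphisms and which is coherent. -/
structure IsCoherentPresentation : Prop where
  injective : ∀ {A B : K} (f : A ⟶ B), Function.Injective (U.map f)
  map_fun : ∀ {A B : K} (f : A ⟶ B) {n : ℕ} (g : L.Functions n) (x : Fin n → U.obj A),
    U.map f (Structure.funMap g x) = Structure.funMap g fun k => (U.map f (x k) : U.obj B)
  map_rel : ∀ {A B : K} (f : A ⟶ B) {n : ℕ} (r : L.Relations n) (x : Fin n → U.obj A),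
    Structure.RelMap r (fun k => (U.map f (x k) : U.obj B)) ↔ Structure.RelMap r x
  full : ∀ {A B : K} (e : U.obj A ≃[L] U.obj B), ∃ f : A ⟶ B, ∀ x, U.map f x = e x
  coherent : IsCoherent U

variable (U) in
/-- An embedding of structures that is isomorphic to one coming from a morphism. -/
def IsMor {M N : Type u} [L.Structure M] [L.Structure N] (g : M ↪[L] N) : Prop :=
  ∃ (A B : K) (f : A ⟶ B) (e : U.obj A ≃[L] M) (e' : U.obj B ≃[L] N),
    ∀ x, g (e x) = e' (U.map f x)

variable {M N P : Type u} [L.Structure M] [L.Structure N] [L.Structure P]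

theorem isMor_equiv (e : M ≃[L] N) (hM : ∃ A : K, Nonempty (U.obj A ≃[L] M)) :
    IsMor U e.toEmbedding := by
  obtain ⟨A, ⟨d⟩⟩ := hM
  exact ⟨A, A, 𝟙 A, d, e.comp d, fun x => by rw [U.map_id]; rfl⟩

namespace IsCoherentPresentation

variable (h : IsCoherentPresentation U L)

include h

/-- Morphisms as embeddings. -/
def emb {A B : K} (f : A ⟶ B) : U.obj A ↪[L] U.obj B where
  toFun := U.map f
  inj' := h.injective f
  map_fun' g x := h.map_fun f g x
  map_rel' r x := h.map_rel f r x

/-- Two presentations of the same structure differ by an isomorphism, which is a morphism by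
iso-fullness; so a presentation of `g` can be moved to any prescribed objects and isomorphisms. -/
theorem exists_hom {g : M ↪[L] N} (hg : IsMor U g) {A B : K} (e : U.obj A ≃[L] M)
    (e' : U.obj B ≃[L] N) : ∃ f : A ⟶ B, ∀ x, g (e x) = e' (U.map f x) := by
  obtain ⟨A', B', f, d, d', hd⟩ := hg
  obtain ⟨a, ha⟩ := h.full (d.symm.comp e)
  obtain ⟨b, hb⟩ := h.full (e'.symm.comp d')
  refine ⟨a ≫ f ≫ b, fun x => ?_⟩
  have : U.map (a ≫ f ≫ b) x = U.map b (U.map f (U.map a x)) := by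
    rw [U.map_comp, U.map_comp]; rfl
  rw [this, hb, ha]
  simp [← hd]

theorem isMor_comp {f : M ↪[L] N} {g : N ↪[L] P} (hf : IsMor U f) (hg : IsMor U g) :
    IsMor U (g.comp f) := by
  obtain ⟨A, B, a, d, d', hd⟩ := hf
  obtain ⟨-, C, -, -, d'', -⟩ := id hg
  obtain ⟨b, hb⟩ := h.exists_hom hg d' d''
  refine ⟨A, C, a ≫ b, d, d'', fun x => ?_⟩
  rw [U.map_comp]
  simp [hd, hb]

theorem isMor_of_comp {f : M ↪[L] N} {g : N ↪[L] P} (hg : IsMor U g) (hgf : IsMor U (g.comp f)) :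
    IsMor U f := by
  obtain ⟨A, C, a, d, d'', hd⟩ := hgf
  obtain ⟨B, -, -, d', -, -⟩ := id hg
  obtain ⟨b, hb⟩ := h.exists_hom hg d' d''
  obtain ⟨f', hf'⟩ := h.coherent a b (↾fun x => d'.symm (f (d x))) <| by
    refine ConcreteCategory.hom_ext _ _ fun x => d''.injective ?_
    have := hd x
    have := hb (d'.symm (f (d x)))
    simp_all
  exact ⟨A, B, f', d, d', fun x => by rw [hf']; simp⟩

end IsCoherentPresentation

theorem IsMor.dom {g : M ↪[L] N} (hg : IsMor U g) : ∃ A : K, Nonempty (U.obj A ≃[L] M) := by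
  obtain ⟨A, -, -, d, -⟩ := hg
  exact ⟨A, ⟨d⟩⟩

theorem IsMor.cod {g : M ↪[L] N} (hg : IsMor U g) : ∃ A : K, Nonempty (U.obj A ≃[L] N) := by
  obtain ⟨-, A, -, -, d, -⟩ := hg
  exact ⟨A, ⟨d⟩⟩

/-- Translates between `≺`, which speaks of substructures, and embeddings, which compose. -/
theorem isMor_subtype_range_iff (h : IsCoherentPresentation U L) (g : M ↪[L] N) :
    IsMor U g.toHom.range.subtype ↔ IsMor U g := by
  constructor
  · intro H
    obtain ⟨A, ⟨e⟩⟩ := H.dom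
    have := h.isMor_comp (isMor_equiv g.equivRange ⟨A, ⟨g.equivRange.symm.comp e⟩⟩) H
    rwa [Embedding.subtype_equivRange] at this
  · intro H
    have := isMor_equiv g.equivRange.symm (by
      obtain ⟨A, ⟨e⟩⟩ := H.dom
      exact ⟨A, ⟨g.equivRange.comp e⟩⟩)
    have := h.isMor_comp this H
    convert this using 1
    ext x
    obtain ⟨y, rfl⟩ := g.equivRange.surjective x
    simp

end Presents

/-! ### The abstract elementary class of a coherent iso-full category of structures -/

namespace IsCoherentPresentation

variable {K : Type v} [Category.{u} K] {U : K ⥤ Type u}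
  {L : FirstOrder.Language.{u, u}} [∀ A, L.Structure (U.obj A)]
  (h : IsCoherentPresentation U L)

include h

/-- The directed union of substructures related by morphisms is a directed colimit. -/
theorem exists_directed_union [U.Faithful] (hK : HasDirectedColimits K)
    (hU : PreservesDirectedColimits U) {N : Type u} [L.Structure N] {I : Type u} [PartialOrder I]
    [IsDirectedOrder I] [Nonempty I] (C : I → L.Substructure N) (hC : Monotone C)
    (hmor : ∀ i j (hij : i ≤ j), IsMor U (Substructure.inclusion (hC hij))) :
    ∃ (A : K) (g : U.obj A ↪[L] N), g.toHom.range = ⨆ i, C i ∧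
      (∀ i, ∃ (B : K) (e : U.obj B ≃[L] C i) (f : B ⟶ A), ∀ x, g (U.map f x) = e x) ∧
      ((∀ i, IsMor U (C i).subtype) → ∀ (B : K) (e : U.obj B ≃[L] N),
        ∃ f : A ⟶ B, ∀ x, g x = e (U.map f x)) := by
  have := hK I
  choose A e using fun i => (hmor i i le_rfl).dom
  replace e := fun i => (e i).some
  choose m hm using fun i j hij => h.exists_hom (hmor i j hij) (e i) (e j)
  have hm' (i j : I) (hij : i ≤ j) (x) : (e j (U.map (m i j hij) x) : N) = e i x := by
    rw [← hm]
    rfl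
  -- Functoriality can be checked inside `N`, where all transition maps become inclusions, since `U`
  -- is faithful and each `e i` is injective.
  let D : I ⥤ K :=
    { obj := A
      map f := m _ _ (leOfHom f)
      map_id i := U.map_injective <| ConcreteCategory.hom_ext _ _ fun x =>
        (e i).injective <| Subtype.ext <| by
          rw [hm', U.map_id]
          rfl
      map_comp {i j k} f f' := U.map_injective <| ConcreteCategory.hom_ext _ _ fun x =>
        (e k).injective <| Subtype.ext <| by
          rw [hm', U.map_comp]
          exact ((hm' j k _ _).trans (hm' i j _ _)).symm }
  let s := colimit.cocone D
  let hs : IsColimit s := colimit.isColimit D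
  have := hU I
  let t : Cocone (D ⋙ U) :=
    { pt := N
      ι :=
        { app i := ↾fun x : U.obj (A i) => (e i x : N)
          naturality i j f := ConcreteCategory.hom_ext _ _ fun x => hm' i j (leOfHom f) x } }
  let g : U.obj s.pt → N := (isColimitOfPreserves U hs).desc t
  have hg (i) (x : U.obj (A i)) : g (U.map (s.ι.app i) x) = e i x :=
    ConcreteCategory.congr_hom ((isColimitOfPreserves U hs).fac t i) x
  have hinj : Function.Injective g := map_ι_injective_of_directed hU hs g fun i x y hxy =>
    (e i).injective <| Subtype.ext <| (hg i x).symm.trans (hxy.trans (hg i y))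
  have hg' (i) {n : ℕ} (y : Fin n → U.obj (A i)) :
      (g ∘ fun k => U.map (s.ι.app i) (y k)) = fun k => ((e i ∘ y) k : N) :=
    funext fun k => hg i (y k)
  -- Symbols are finitary, so each instance of a symbol lives at a single stage, where `e i` is an
  -- isomorphism.
  let G : U.obj s.pt ↪[L] N :=
    { toFun := g
      inj' := hinj
      map_fun' f x := by
        obtain ⟨i, y, rfl⟩ := exists_eq_map_ι_tuple hU hs x
        rw [hg', ← h.map_fun]
        refine (hg i _).trans ?_
        rw [(e i).map_fun]
        rfl
      map_rel' r x := by
        obtain ⟨i, y, rfl⟩ := exists_eq_map_ι_tuple hU hs x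
        rw [hg']
        exact ((e i).map_rel r y).trans (h.map_rel _ r y).symm }
  have hG (i) (x : U.obj (A i)) : G (U.map (s.ι.app i) x) = e i x := hg i x
  refine ⟨s.pt, G, ?_, fun i => ⟨A i, e i, s.ι.app i, hG i⟩, fun hN B d => ?_⟩
  · ext x
    rw [Substructure.mem_iSup_of_directed hC.directed_le]
    constructor
    · rintro ⟨y, rfl⟩
      obtain ⟨i, z, rfl⟩ := exists_eq_map_ι hU hs y
      exact ⟨i, by
        have := (e i z).2
        rwa [← hG] at this⟩
    · rintro ⟨i, hx⟩
      obtain ⟨z, hz⟩ := (e i).surjective ⟨x, hx⟩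
      exact ⟨U.map (s.ι.app i) z, (hG i z).trans (congrArg Subtype.val hz)⟩
  -- When all `C i` are strong in `N`, they form a cocone in `K` over an object presenting `N`; the
  -- universal property supplies the morphism.
  · choose c hc using fun i => h.exists_hom (hN i) (e i) d
    let T : Cocone D :=
      { pt := B
        ι :=
          { app := c
            naturality i j f := U.map_injective <| ConcreteCategory.hom_ext _ _ fun x =>
              d.injective <| by
                rw [U.map_comp, U.map_comp]
                refine (hc j _).symm.trans ((hm' i j (leOfHom f) x).trans ((hc i x).trans ?_))
                simp } }
    refine ⟨hs.desc T, fun y => ?_⟩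
    obtain ⟨i, z, rfl⟩ := exists_eq_map_ι hU hs y
    rw [map_desc_map_ι]
    exact (hG i z).trans (hc i z)

theorem isMor_inclusion {N : Type u} [L.Structure N] {S T : L.Substructure N} (hST : S ≤ T)
    (hS : IsMor U S.subtype) (hT : IsMor U T.subtype) : IsMor U (Substructure.inclusion hST) :=
  h.isMor_of_comp hT (by rwa [Substructure.subtype_comp_inclusion])

theorem isMor_comap_subtype_iff {N : Type u} [L.Structure N] {S T : L.Substructure N}
    (hST : S ≤ T) : IsMor U (S.comap T.subtype.toHom).subtype ↔
      IsMor U (Substructure.inclusion hST) := by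
  have : S.comap T.subtype.toHom = (Substructure.inclusion hST).toHom.range := by
    ext x
    exact ⟨fun hx => ⟨⟨x, hx⟩, rfl⟩, by rintro ⟨y, rfl⟩; exact y.2⟩
  rw [this, isMor_subtype_range_iff h]

/-- The abstract elementary class of a coherent iso-full category of structures. -/
def toAEC [IsAccessibleCategory.{u} K] [U.Faithful] (hK : HasDirectedColimits K)
    (hU : PreservesDirectedColimits U) : AEC L where
  Mem M _ := ∃ A : K, Nonempty (U.obj A ≃[L] M)
  Strong S := IsMor U S.subtype
  mem_of_strong S hS := ⟨hS.dom, hS.cod⟩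
  mem_of_equiv e := fun ⟨A, ⟨d⟩⟩ => ⟨A, ⟨e.comp d⟩⟩
  strong_of_equiv {M N} _ _ e S hS := by
    have := h.isMor_comp hS (isMor_equiv e hS.cod)
    rw [← isMor_subtype_range_iff h] at this
    convert this using 2 <;>
    · ext x
      simp [Hom.mem_range, Substructure.mem_map]
  strong_top M _ := fun ⟨A, ⟨d⟩⟩ =>
    isMor_equiv Substructure.topEquiv ⟨A, ⟨Substructure.topEquiv.symm.comp d⟩⟩
  strong_trans S T hT hS := by
    have := h.isMor_comp hT hS
    rw [← isMor_subtype_range_iff h] at this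
    have e : T.map S.subtype.toHom = (S.subtype.comp T.subtype).toHom.range := by
      ext x
      simp [Hom.mem_range, Substructure.mem_map]
    rwa [e]
  coherence S T hST hS hT := (h.isMor_comap_subtype_iff hST).2 (h.isMor_inclusion hST hS hT)
  chain_union {N} _ {I} _ _ _ C hC _ hs htop := by
    obtain ⟨A, g, hg, hB, -⟩ := h.exists_directed_union hK hU C hC fun i j hij =>
      (h.isMor_comap_subtype_iff (hC hij)).1 (hs i j hij)
    have hsurj : Function.Surjective g := Hom.range_eq_top.1 (hg.trans htop)
    let E : U.obj A ≃[L] N :=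
      ⟨Equiv.ofBijective g ⟨g.injective, hsurj⟩, fun f x => g.map_fun f x,
        fun r x => g.map_rel r x⟩
    refine ⟨⟨A, ⟨E⟩⟩, fun i => ?_⟩
    obtain ⟨B, e, f, hf⟩ := hB i
    exact ⟨B, A, f, e, E, fun x => (hf x).symm⟩
  chain_smooth {N} _ {I} _ _ hI C hC _ hs := by
    obtain ⟨A, g, hg, -, hB⟩ := h.exists_directed_union hK hU C hC fun i j hij =>
      h.isMor_inclusion (hC hij) (hs i) (hs j)
    obtain ⟨B, ⟨e⟩⟩ := (hs (Classical.choice hI)).cod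
    obtain ⟨f, hf⟩ := hB hs B e
    rw [← hg, isMor_subtype_range_iff h]
    exact ⟨A, B, f, Language.Equiv.refl L _, e, hf⟩
  lowenheim_skolem := by
    obtain ⟨κ, hκ, H⟩ := exists_lowenheimSkolem_cardinal hK hU
    refine ⟨max κ L.card, hκ.trans (le_max_left _ _), le_max_right _ _, ?_⟩
    rintro N _ ⟨B, ⟨e⟩⟩ X
    obtain ⟨A, f, hf, hA⟩ := H B (e ⁻¹' X)
    let g : U.obj A ↪[L] N := e.toEmbedding.comp (h.emb f)
    refine ⟨g.toHom.range, fun x hx => ?_, ?_, ?_⟩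
    · obtain ⟨y, hy⟩ := hf (show e.symm x ∈ e ⁻¹' X by simpa using hx)
      exact ⟨y, show e (U.map f y) = x by rw [hy]; simp⟩
    · rw [isMor_subtype_range_iff h]
      exact ⟨A, B, f, Language.Equiv.refl L _, e, fun _ => rfl⟩
    · refine (Cardinal.mk_congr g.equivRange.toEquiv).ge.trans (hA.trans (max_le_max ?_ ?_))
      · exact Cardinal.mk_preimage_of_injective _ _ e.injective
      · exact le_max_left _ _

/-- Fullness is `exists_hom` with identities as isomorphisms; essential surjectivity holds because
members are isomorphic to some `UA` and isomorphisms are strong. -/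
theorem isAEC [IsAccessibleCategory.{u} K] [U.Faithful] (hK : HasDirectedColimits K)
    (hU : PreservesDirectedColimits U) : IsAEC U := by
  let F : K ⥤ (h.toAEC hK hU).Model :=
    { obj A := ⟨U.obj A, ⟨A, ⟨Language.Equiv.refl L _⟩⟩⟩
      map {A B} f := ⟨h.emb f, (isMor_subtype_range_iff h _).2
        ⟨A, B, f, Language.Equiv.refl L _, Language.Equiv.refl L _, fun _ => rfl⟩⟩
      map_id A := Subtype.ext <| Embedding.ext fun x => ConcreteCategory.congr_hom (U.map_id A) x
      map_comp f g := Subtype.ext <| Embedding.ext fun x =>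
        ConcreteCategory.congr_hom (U.map_comp f g) x }
  have hfaithful : F.Faithful := ⟨fun {A B f g} hfg => U.map_injective <|
    ConcreteCategory.hom_ext _ _ fun x =>
      congrArg (fun k : U.obj A ↪[L] U.obj B => k x) (congrArg Subtype.val hfg)⟩
  have hfull : F.Full := ⟨fun {A B} f => by
    obtain ⟨a, ha⟩ := h.exists_hom ((isMor_subtype_range_iff h _).1 f.2)
      (Language.Equiv.refl L (U.obj A)) (Language.Equiv.refl L (U.obj B))
    exact ⟨a, Subtype.ext <| Embedding.ext fun x => (ha x).symm⟩⟩
  have hess : F.EssSurj := ⟨fun M => by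
    obtain ⟨A, ⟨e⟩⟩ := M.mem
    exact ⟨A, ⟨
      { hom := ⟨e.toEmbedding, (isMor_subtype_range_iff h _).2 (isMor_equiv e ⟨A, ⟨.refl L _⟩⟩)⟩
        inv := ⟨e.symm.toEmbedding, (isMor_subtype_range_iff h _).2 (isMor_equiv e.symm M.mem)⟩
        hom_inv_id := Subtype.ext <| Embedding.ext fun x => e.symm_apply_apply x
        inv_hom_id := Subtype.ext <| Embedding.ext fun x => e.apply_symm_apply x }⟩⟩⟩
  exact ⟨L, h.toAEC hK hU, F, {}, ⟨Iso.refl _⟩⟩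

end IsCoherentPresentation

/-! ### The signature `Σ₀`, made small -/

section SmallSignature

variable {K : Type v} [Category.{u} K] (U : K ⥤ Type u)
  [∀ n, Small.{u} ((canonicalSignature U).Functions n)]
  [∀ n, Small.{u} ((canonicalSignature U).Relations n)]

/-- A copy of the signature `Σ₀` in the universe `u`. -/
def smallEmbeddingSignature : FirstOrder.Language.{u, u} where
  Functions n := Shrink.{u} ((embeddingSignature U).funs n)
  Relations n := Shrink.{u} ((embeddingSignature U).rels n)

noncomputable instance smallEmbeddingStructure (A : K) : (smallEmbeddingSignature U).Structure (U.obj A) where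
  funMap {n} g x := ((equivShrink.{u} ((embeddingSignature U).funs n)).symm g).1.app A x
  RelMap {n} r x := x ∈ ((equivShrink.{u} ((embeddingSignature U).rels n)).symm r).1.1.obj A

variable {U} in
theorem isCoherentPresentation_smallEmbeddingSignature
    (hinj : ∀ {A B : K} (f : A ⟶ B), Function.Injective (U.map f)) (hcoh : IsCoherent U)
    (hfull : IsIsoFull (inducedFunctor U (embeddingSignature U))) :
    IsCoherentPresentation U (smallEmbeddingSignature U) where
  injective := hinj
  map_fun {A B} f {n} g x := (ConcreteCategory.congr_hom
    (((equivShrink.{u} ((embeddingSignature U).funs n)).symm g).1.naturality f) x).symm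
  map_rel {A B} f {n} r x := by
    let R := (equivShrink.{u} ((embeddingSignature U).rels n)).symm r
    exact ⟨(landsInEmb_iff hinj _).1 (isGreatest_embeddingSignature hinj).1 n R.1 R.2 f x,
      fun hx => R.1.1.map f hx⟩
  full {A B} e := by
    let e' : ((inducedFunctor U (embeddingSignature U)).obj A).carrier
        ≃[(embeddingSignature U).toLanguage]
        ((inducedFunctor U (embeddingSignature U)).obj B).carrier :=
      { toEquiv := e.toEquiv
        map_fun' {n} g x := by
          obtain ⟨g, rfl⟩ := (equivShrink.{u} ((embeddingSignature U).funs n)).symm.surjective g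
          exact e.map_fun g x
        map_rel' {n} r x := by
          obtain ⟨r, rfl⟩ := (equivShrink.{u} ((embeddingSignature U).rels n)).symm.surjective r
          exact e.map_rel r x }
    obtain ⟨f, hf⟩ := hfull e'
    exact ⟨f, fun x => congrFun (congrArg FirstOrder.Language.Hom.toFun hf) x⟩
  coherent := hcoh

end SmallSignature

/-! ### Abstract elementary classes are coherent and iso-full -/

namespace AEC

variable {L : FirstOrder.Language.{u, u}} (𝔸 : AEC L)

theorem isStrongEmbedding_equiv {M N : Type u} [L.Structure M] [L.Structure N] (e : M ≃[L] N)
    (hM : 𝔸.Mem M) : 𝔸.IsStrongEmbedding e.toEmbedding := by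
  have := 𝔸.strong_of_equiv e _ (𝔸.strong_top M hM)
  rwa [← Hom.range_eq_map] at this

/-- Apply the coherence axiom to the images of `g.comp f` and `g` in `P`, then transport back along
`N ≃ g.toHom.range`. -/
theorem isStrongEmbedding_of_comp {M N P : Type u} [L.Structure M] [L.Structure N] [L.Structure P]
    (g : N ↪[L] P) (f : M ↪[L] N) (hg : 𝔸.IsStrongEmbedding g)
    (hgf : 𝔸.IsStrongEmbedding (g.comp f)) : 𝔸.IsStrongEmbedding f := by
  have h := 𝔸.coherence (g.comp f).toHom.range g.toHom.range
    (by rintro _ ⟨x, rfl⟩; exact ⟨f x, rfl⟩) hgf hg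
  have h' := 𝔸.strong_of_equiv g.equivRange.symm _ h
  unfold IsStrongEmbedding
  convert h' using 1
  ext y
  constructor
  · rintro ⟨x, rfl⟩
    exact ⟨g.equivRange (f x), ⟨x, rfl⟩, g.equivRange.symm_apply_apply (f x)⟩
  · rintro ⟨z, ⟨x, hx⟩, rfl⟩
    have : z = g.equivRange (f x) := Subtype.ext hx.symm
    subst this
    exact ⟨x, (g.equivRange.symm_apply_apply (f x)).symm⟩

/-- A map whose composite with a strong embedding is a strong embedding is a strong embedding. -/
theorem exists_hom_of_comp_eq {M N P : 𝔸.Model} (k : M ⟶ P) (g : N ⟶ P)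
    (f : M.carrier → N.carrier) (h : ∀ x, g.1 (f x) = k.1 x) :
    ∃ f' : M ⟶ N, ∀ x, f'.1 x = f x := by
  -- `f` is an embedding because `k` is one and `g` is injective and reflects relations.
  let e : M.carrier ↪[L] N.carrier :=
    { toFun := f
      inj' := fun x y hxy => k.1.injective <| by rw [← h, ← h, hxy]
      map_fun' s x := g.1.injective <| by
        rw [h, k.1.map_fun, g.1.map_fun]
        exact congrArg _ (funext fun i => (h (x i)).symm)
      map_rel' r x := by
        rw [← g.1.map_rel, ← k.1.map_rel]
        exact iff_of_eq (congrArg _ (funext fun i => h (x i))) }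
  refine ⟨⟨e, 𝔸.isStrongEmbedding_of_comp g.1 e g.2 ?_⟩, fun x => rfl⟩
  have : g.1.comp e = k.1 := Embedding.ext h
  rw [this]
  exact k.2

end AEC

section OfAEC

variable {K : Type v} [Category.{u} K] {U : K ⥤ Type u} {L : FirstOrder.Language.{u, u}}
  {𝔸 : AEC L} {F : K ⥤ 𝔸.Model} {ε : ∀ A, (F.obj A).carrier ≃ U.obj A}
  (hε : ∀ {A B : K} (f : A ⟶ B) (x : (F.obj A).carrier),
    U.map f (ε A x) = ε B ((F.map f).1 x))

include hε

theorem symm_map {A B : K} (f : A ⟶ B) (x : U.obj A) :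
    (ε B).symm (U.map f x) = (F.map f).1 ((ε A).symm x) := by
  rw [Equiv.symm_apply_eq, ← hε, Equiv.apply_symm_apply]

theorem isCoherent_of_full_model [F.Full] : IsCoherent U := by
  intro A B C h g f hfg
  obtain ⟨f', hf'⟩ := 𝔸.exists_hom_of_comp_eq (F.map h) (F.map g)
    (fun x => (ε B).symm (f (ε A x))) fun x => by
      rw [← symm_map hε, Equiv.symm_apply_eq, ← hε]
      exact ConcreteCategory.congr_hom hfg _
  refine ⟨F.preimage f', ConcreteCategory.hom_ext _ _ fun x => ?_⟩
  obtain ⟨y, rfl⟩ := (ε A).surjective x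
  rw [hε, F.map_preimage, hf', Equiv.apply_symm_apply]

/-- A function symbol of `L`, as a function symbol of the canonical signature. -/
def canonicalFunction {n : ℕ} (g : L.Functions n) : (canonicalSignature U).Functions n :=
  show power U n ⟶ U from
  { app A := ↾fun x : Fin n → U.obj A => ε A (Structure.funMap g fun k => (ε A).symm (x k))
    naturality A B f := ConcreteCategory.hom_ext _ _ fun x => by
      refine Eq.trans ?_ (hε f _).symm
      rw [(F.map f).1.map_fun]
      exact congrArg (ε B) (congrArg (Structure.funMap g) (funext fun k => symm_map hε f (x k))) }

/-- A relation symbol of `L`, as a subfunctor of `Uⁿ`. -/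
def canonicalRelation {n : ℕ} (r : L.Relations n) : Subfunctor (power U n) where
  obj A := {x : Fin n → U.obj A | Structure.RelMap r fun k => (ε A).symm (x k)}
  map {A B} f x hx := by
    have := ((F.map f).1.map_rel r _).2 hx
    refine (iff_of_eq (congrArg (Structure.RelMap r) (funext fun k => ?_))).1 this
    exact (symm_map hε f (x k)).symm

/-- Used twice: it makes the subfunctor preserve directed colimits, hence a canonical symbol, and it
puts that symbol in `Σ₀`. -/
theorem canonicalRelation_reflected {n : ℕ} (r : L.Relations n) {A B : K} (f : A ⟶ B)
    (x : Fin n → U.obj A) (hx : (fun k => U.map f (x k)) ∈ (canonicalRelation hε r).obj B) :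
    x ∈ (canonicalRelation hε r).obj A := by
  refine ((F.map f).1.map_rel r _).1 ?_
  refine (iff_of_eq (congrArg (Structure.RelMap r) (funext fun k => ?_))).1 hx
  exact symm_map hε f (x k)

theorem isIsoFull_of_full_model [F.Full] (hU : PreservesDirectedColimits U)
    (hinj : ∀ {A B : K} (f : A ⟶ B), Function.Injective (U.map f)) :
    IsIsoFull (inducedFunctor U (embeddingSignature U)) := by
  intro A B e
  let φ : U.obj A ≃ U.obj B := e.toEquiv
  -- Conjugating by `ε` turns `e` into an isomorphism of `L`-structures, as all symbols of `L` occur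
  -- in `Σ₀`.
  let d : (F.obj A).carrier ≃[L] (F.obj B).carrier :=
    { toEquiv := ((ε A).trans φ).trans (ε B).symm
      map_fun' {n} g x := by
        have := e.map_fun (⟨canonicalFunction hε g, mem_embeddingSignature_funs hinj _⟩ :
          (embeddingSignature U).toLanguage.Functions n) fun k => ε A (x k)
        replace this : φ (ε A (Structure.funMap g fun k => (ε A).symm (ε A (x k)))) =
            ε B (Structure.funMap g fun k => (ε B).symm (φ (ε A (x k)))) := this
        simp only [Equiv.symm_apply_apply] at this
        exact (ε B).symm_apply_eq.2 this
      map_rel' {n} r x := by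
        have := e.map_rel (⟨⟨canonicalRelation hε r, preservesDirectedColimits_of_reflected hU
            hinj _ (canonicalRelation_reflected hε r)⟩, mem_embeddingSignature_rels hinj _
            fun _ _ f x => canonicalRelation_reflected hε r f x⟩ :
          (embeddingSignature U).toLanguage.Relations n) fun k => ε A (x k)
        replace this : (Structure.RelMap r fun k => (ε B).symm (φ (ε A (x k)))) ↔
            Structure.RelMap r fun k => (ε A).symm (ε A (x k)) := this
        simp only [Equiv.symm_apply_apply] at this
        exact this }
  let f : F.obj A ⟶ F.obj B := ⟨d.toEmbedding, 𝔸.isStrongEmbedding_equiv d (F.obj A).mem⟩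
  refine ⟨F.preimage f, FirstOrder.Language.Hom.ext fun x => ?_⟩
  obtain ⟨y, rfl⟩ := (ε A).surjective x
  change U.map (F.preimage f) (ε A y) = φ (ε A y)
  rw [hε, F.map_preimage]
  exact (ε B).apply_symm_apply _

end OfAEC

end LanguageFreeAEC

theorem mainTheorem9 {K : Type v} [Category.{u} K] [IsAccessibleCategory.{u} K]
    (hK : HasDirectedColimits K)
    (U : K ⥤ Type u) [U.Faithful] (hU : PreservesDirectedColimits U)
    (hmono : ∀ {A B : K} (f : A ⟶ B), Mono f ∧ Mono (U.map f)) :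
    ((∀ n, Small.{u} ((canonicalSignature U).Functions n)) ∧
      (∀ n, Small.{u} ((canonicalSignature U).Relations n))) ∧
    IsGreatest {S : Subsignature (canonicalSignature U) | LandsInEmb U S}
      (embeddingSignature U) ∧
    (IsAEC U ↔
      IsCoherent U ∧ IsIsoFull (inducedFunctor U (embeddingSignature U))) := by
  have hinj {A B : K} (f : A ⟶ B) : Function.Injective (U.map f) :=
    (mono_iff_injective _).1 (hmono f).2
  have hfuns := small_functions hU
  have hrels := small_relations (U := U)
  refine ⟨⟨hfuns, hrels⟩, isGreatest_embeddingSignature hinj, ?_, fun ⟨hcoh, hfull⟩ =>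
    (isCoherentPresentation_smallEmbeddingSignature hinj hcoh hfull).isAEC hK hU⟩
  rintro ⟨L, 𝔸, F, _, ⟨η⟩⟩
  let ε (A : K) : (F.obj A).carrier ≃ U.obj A := (η.app A).toEquiv
  have hε {A B : K} (f : A ⟶ B) (x : (F.obj A).carrier) :
      U.map f (ε A x) = ε B ((F.map f).1 x) :=
    (ConcreteCategory.congr_hom (η.hom.naturality f) x).symm
  exact ⟨isCoherent_of_full_model hε, isIsoFull_of_full_model hε hU hinj⟩
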